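/- Let $k_0>0$, let $\mathbb S^2_{k_0}=\{x\in\mathbb R^3:\|x\|=k_0\}$, and let $\nu,\omega\in\mathbb R^3\setminus\{0\}$ (only their directions matter, so one may take them to be unit vectors). For $v\in\mathbb R^3\setminus\{0\}$ write $S_v=\{x\in\mathbb S^2_{k_0}:\langle x,v\rangle>0\}$, and let $H_\nu x=x-2\frac{\langle x,\nu\rangle}{\|\nu\|^2}\nu$ be the reflection across the plane $\nu^\perp$. Put $$\Sigma_1=\{\sigma\in S_\omega: H_\nu\sigma\notin S_\omega\},\qquad \Sigma_2=\{\sigma\in S_\omega: H_\nu\sigma\in S_\omega\}.$$ Let $\chi\in(0,1)$ and let $\Sigma_{2,\chi}=\{t\sigma:\sigma\in\Sigma_2,\ t\in(1-\chi,1+\chi)\}$, an open subset of $\mathbb R^3$. Let $b\in C^2(\Sigma_{2,\chi};\mathbb C)$ be nowhere zero and satisfy $b(t\sigma)=b(\sigma)$ for all $\sigma\in\Sigma_2$ and $t\in(1-\chi,1+\chi)$. Let $e_3=(0,0,1)$, and let $\eta\in S_{e_3}$ and $\sigma\in\Sigma_2$ be such that $\eta,\sigma,\nu$ are linearly independent and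 $$\mathrm Db(\sigma)(\nu\times\sigma)\neq0 .$$ Then every continuous function $g:\mathbb R^3\to\mathbb C$ that satisfies, for all $\eta'\in S_{e_3}$, $$g(\eta'-\sigma')=0\ \text{ for all }\sigma'\in\Sigma_1,\qquad b(\sigma')\,g(\eta'-\sigma')+g(\eta'-H_\nu\sigma')=0\ \text{ for all }\sigma'\in\Sigma_2,$$ fulfills $g(\eta-\sigma)=0$. -/

import Mathlib

namespace Scan

/-- Three-dimensional Euclidean space. -/
abbrev E3 : Type := EuclideanSpace ℝ (Fin 3)

/-- The third standard basis vector. -/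
noncomputable def e3 : E3 := EuclideanSpace.single 2 1

/-- The vector product on Euclidean three-space. -/
noncomputable def cross (u v : E3) : E3 :=
  WithLp.toLp 2 (crossProduct (WithLp.ofLp u) (WithLp.ofLp v))

/-- The open half-space in the direction of `v`. -/
def halfSpace (v : E3) : Set E3 := {x | 0 < inner ℝ x v}

/-- The open hemisphere of radius `k₀` in the direction of `v`. -/
def hemisphere (k₀ : ℝ) (v : E3) : Set E3 := Metric.sphere 0 k₀ ∩ halfSpace v

/-- The reflection across the plane orthogonal to a non-zero vector `v`, not necessarily
of unit length. -/
noncomputable def refl (v x : E3) : E3 := x - (2 * inner ℝ x v / ‖v‖ ^ 2) • v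

/-- For a unit vector, `refl` is the Householder transform `x - 2 ⟨x, v⟩ v`. -/
theorem refl_of_norm_eq_one {v : E3} (hv : ‖v‖ = 1) (x : E3) :
    refl v x = x - (2 * inner ℝ x v) • v := by
  simp [refl, hv]

/-- The directions in the hemisphere around `ω` whose reflection leaves the hemisphere. -/
def Sigma1 (k₀ : ℝ) (ω ν : E3) : Set E3 :=
  {σ | σ ∈ hemisphere k₀ ω ∧ refl ν σ ∉ hemisphere k₀ ω}

/-- The directions in the hemisphere around `ω` whose reflection stays in the hemisphere. -/
def Sigma2 (k₀ : ℝ) (ω ν : E3) : Set E3 :=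
  {σ | σ ∈ hemisphere k₀ ω ∧ refl ν σ ∈ hemisphere k₀ ω}

/-- The radial open neighbourhood of `Sigma2`, on which the coefficient function lives. -/
def Sigma2Nhd (k₀ : ℝ) (ω ν : E3) (χ : ℝ) : Set E3 :=
  {x | ∃ σ ∈ Sigma2 k₀ ω ν, ∃ t ∈ Set.Ioo (1 - χ) (1 + χ), x = t • σ}

/-- `g` solves the homogeneous linear system with coefficient function `b`. -/
def IsSolution (k₀ : ℝ) (ω ν : E3) (b g : E3 → ℂ) : Prop :=
  ∀ η ∈ hemisphere k₀ e3,
    (∀ σ ∈ Sigma1 k₀ ω ν, g (η - σ) = 0) ∧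
    (∀ σ ∈ Sigma2 k₀ ω ν, b σ * g (η - σ) + g (η - refl ν σ) = 0)

end Scan

/-!
Suppose `g (η - σ) ≠ 0`, and let `n` be the unit vector in the direction of `ν`. The difference
`η - refl n σ` differs from `η - σ` only in the direction of `n`. Fix the component `r u` of `η - σ`
orthogonal to `n` and write `η - σ = r u + z n` and `η - refl n σ = r u + z' n`. Near the given pair,
`σ` is a function of `(z, z')` on the sphere (`spherePoint`), and the equation for `g` becomes
`b (σ (z, z')) * g (r u + z n) = -g (r u + z' n)`. As `g` does not vanish there, `b` is locally a
product of a function of `z` and a function of `z'` (`eventually_separated`). Hence `F = b ∘ σ`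
satisfies `F ∂₁∂₂F = ∂₁F ∂₂F` (`second_order_of_separated`). No differentiability of `g` is
needed.

By the chain rule this is a relation between the first two derivatives of `b` at `σ`, with
coefficients that depend on `η` (`exists_second_order_relation`). It holds for every admissible
`η'` near `η`, with the same `σ`. Take `η' = (k / v) (p + τ n)`, where `p` is a fixed unit vector
orthogonal to `n` and `v = √(1 + τ ^ 2)`. The relation then turns out to be a cubic polynomial
equation in `v` with constant coefficients (`tangent_coords`). The `v ^ 3` term comes only from
the component of `∂₁∂₂σ` in the direction of `ν × σ`, and its coefficient is a nonzero multiple of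
`b σ` times the derivative of `b` at `σ` in that direction. It has to vanish, which contradicts
the assumption on `b` (`fderiv_apply_eq_zero`).
-/

open Filter Topology

namespace Scan

/-! ### Orthonormal frames -/

theorem orthonormal_three {u w n : E3} :
    Orthonormal ℝ ![u, w, n] ↔ inner ℝ u u = 1 ∧ inner ℝ w w = 1 ∧ inner ℝ n n = 1 ∧
      inner ℝ u w = 0 ∧ inner ℝ u n = 0 ∧ inner ℝ w n = 0 := by
  rw [orthonormal_iff_ite]
  constructor
  · intro h
    exact ⟨by simpa using h 0 0, by simpa using h 1 1, by simpa using h 2 2,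
      by simpa using h 0 1, by simpa using h 0 2, by simpa using h 1 2⟩
  · rintro ⟨h1, h2, h3, h4, h5, h6⟩ i j
    have h4' := (real_inner_comm u w).trans h4
    have h5' := (real_inner_comm u n).trans h5
    have h6' := (real_inner_comm w n).trans h6
    fin_cases i <;> fin_cases j <;> simp_all

theorem inner_frame {u w n : E3} (h : Orthonormal ℝ ![u, w, n]) (a b c a' b' c' : ℝ) :
    inner ℝ (a • u + b • w + c • n) (a' • u + b' • w + c' • n) = a * a' + b * b' + c * c' := by
  obtain ⟨h1, h2, h3, h4, h5, h6⟩ := orthonormal_three.1 h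
  have h4' := (real_inner_comm u w).trans h4
  have h5' := (real_inner_comm u n).trans h5
  have h6' := (real_inner_comm w n).trans h6
  simp only [inner_add_left, inner_add_right, real_inner_smul_left, real_inner_smul_right, h1, h2,
    h3, h4, h5, h6, h4', h5', h6']
  ring

theorem inner_frame_right {u w n : E3} (h : Orthonormal ℝ ![u, w, n]) (a b c : ℝ) :
    inner ℝ (a • u + b • w + c • n) n = c := by
  simpa using inner_frame h a b c 0 0 1

theorem inner_frame_left {u w n : E3} (h : Orthonormal ℝ ![u, w, n]) (a b c : ℝ) :
    inner ℝ (a • u + b • w + c • n) u = a ∧ inner ℝ (a • u + b • w + c • n) w = b := by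
  constructor
  · simpa using inner_frame h a b c 1 0 0
  · simpa using inner_frame h a b c 0 1 0

theorem exists_coord {u w n : E3} (h : Orthonormal ℝ ![u, w, n]) (x : E3) :
    ∃ a b c : ℝ, x = a • u + b • w + c • n := by
  let B := basisOfOrthonormalOfCardEqFinrank h (by simp)
  refine ⟨B.repr x 0, B.repr x 1, B.repr x 2, ?_⟩
  have := B.sum_repr x
  rw [Fin.sum_univ_three] at this
  simpa [B] using this.symm

theorem linearIndependent_three {a b n : E3} :
    LinearIndependent ℝ ![a, b, n] ↔
      ∀ x y z : ℝ, x • a + y • b + z • n = 0 → x = 0 ∧ y = 0 ∧ z = 0 := by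
  rw [Fintype.linearIndependent_iff]
  constructor
  · intro h x y z hxyz
    have := h ![x, y, z] (by simpa [Fin.sum_univ_three] using hxyz)
    exact ⟨this 0, this 1, this 2⟩
  · intro h c hc i
    have := h (c 0) (c 1) (c 2) (by simpa [Fin.sum_univ_three] using hc)
    fin_cases i <;> simp [this]

/-- Gram–Schmidt for `n, a, b`, started at the unit vector `n`; the leading coefficients `r` and
`q` are positive. -/
theorem exists_frame {a b n : E3} (hn : ‖n‖ = 1) (hind : LinearIndependent ℝ ![a, b, n]) :
    ∃ (u w : E3) (r z c q s : ℝ), Orthonormal ℝ ![u, w, n] ∧ 0 < r ∧ 0 < q ∧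
      a = r • u + z • n ∧ b = c • u + q • w + s • n := by
  rw [linearIndependent_three] at hind
  have hnn : inner ℝ n n = (1 : ℝ) := by rw [real_inner_self_eq_norm_sq, hn, one_pow]
  obtain ⟨z, hz⟩ : ∃ z : ℝ, z = inner ℝ a n := ⟨_, rfl⟩
  obtain ⟨a', ha'⟩ : ∃ a', a' = a - z • n := ⟨_, rfl⟩
  have ha0 : a' ≠ 0 := by
    intro h0
    have := hind 1 0 (-z) (by rw [← h0, ha']; module)
    simp at this
  have hr : 0 < ‖a'‖ := norm_pos_iff.2 ha0
  obtain ⟨u, hu⟩ : ∃ u, u = ‖a'‖⁻¹ • a' := ⟨_, rfl⟩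
  have hau : a' = ‖a'‖ • u := by rw [hu, smul_smul, mul_inv_cancel₀ hr.ne', one_smul]
  have hun : inner ℝ u n = (0 : ℝ) := by
    rw [hu, real_inner_smul_left, ha', inner_sub_left, real_inner_smul_left, hnn, hz]; ring
  have huu : inner ℝ u u = (1 : ℝ) := by
    rw [real_inner_self_eq_norm_sq, hu, norm_smul, norm_inv, norm_norm,
      inv_mul_cancel₀ hr.ne', one_pow]
  obtain ⟨s, hs⟩ : ∃ s : ℝ, s = inner ℝ b n := ⟨_, rfl⟩
  obtain ⟨c, hc⟩ : ∃ c : ℝ, c = inner ℝ b u := ⟨_, rfl⟩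
  obtain ⟨b', hb'⟩ : ∃ b', b' = b - s • n - c • u := ⟨_, rfl⟩
  have hb0 : b' ≠ 0 := by
    intro h0
    have := hind (-(c * ‖a'‖⁻¹)) 1 (-s + c * ‖a'‖⁻¹ * z) (by
      rw [← h0, hb', hu, ha']; module)
    simp at this
  have hq : 0 < ‖b'‖ := norm_pos_iff.2 hb0
  obtain ⟨w, hw⟩ : ∃ w, w = ‖b'‖⁻¹ • b' := ⟨_, rfl⟩
  have hbw : b' = ‖b'‖ • w := by rw [hw, smul_smul, mul_inv_cancel₀ hq.ne', one_smul]
  have hwn : inner ℝ w n = (0 : ℝ) := by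
    rw [hw, real_inner_smul_left, hb', inner_sub_left, inner_sub_left, real_inner_smul_left,
      real_inner_smul_left, hnn, hun, hs]; ring
  have hwu : inner ℝ u w = (0 : ℝ) := by
    rw [real_inner_comm, hw, real_inner_smul_left, hb', inner_sub_left, inner_sub_left,
      real_inner_smul_left, real_inner_smul_left, huu, real_inner_comm u n, hun, hc]; ring
  have hww : inner ℝ w w = (1 : ℝ) := by
    rw [real_inner_self_eq_norm_sq, hw, norm_smul, norm_inv, norm_norm,
      inv_mul_cancel₀ hq.ne', one_pow]
  refine ⟨u, w, ‖a'‖, z, c, ‖b'‖, s, orthonormal_three.2 ⟨huu, hww, hnn, hwu, hun, hwn⟩,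
    hr, hq, ?_, ?_⟩
  · rw [← hau, ha']; module
  · rw [← hbw, hb']; module

/-! ### Reflections and the sets of admissible directions -/

theorem refl_smul {c : ℝ} (hc : c ≠ 0) (v x : E3) : refl (c • v) x = refl v x := by
  unfold refl
  rw [real_inner_smul_right, norm_smul, mul_pow, smul_smul, Real.norm_eq_abs, sq_abs]
  congr 2
  by_cases hv : ‖v‖ ^ 2 = 0
  · simp [hv]
  · field_simp

theorem norm_refl {v : E3} (hv : v ≠ 0) (x : E3) : ‖refl v x‖ = ‖x‖ := by
  have h : ‖v‖ ≠ 0 := norm_ne_zero_iff.2 hv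
  rw [← sq_eq_sq₀ (norm_nonneg _) (norm_nonneg _), refl, norm_sub_sq_real, norm_smul,
    real_inner_smul_right, mul_pow, Real.norm_eq_abs, sq_abs]
  field_simp
  ring

theorem continuous_refl (v : E3) : Continuous (refl v) := by
  unfold refl
  fun_prop

theorem mem_hemisphere {k : ℝ} {v x : E3} :
    x ∈ hemisphere k v ↔ ‖x‖ = k ∧ 0 < inner ℝ x v := by
  simp [hemisphere, halfSpace]

theorem mem_Sigma2 {k : ℝ} {ω ν x : E3} (hν : ν ≠ 0) :
    x ∈ Sigma2 k ω ν ↔ ‖x‖ = k ∧ 0 < inner ℝ x ω ∧ 0 < inner ℝ (refl ν x) ω := by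
  simp only [Sigma2, Set.mem_ofPred_eq, mem_hemisphere, norm_refl hν]
  tauto

/-- The radial neighbourhood of `Sigma2` is a genuine neighbourhood, because `Sigma2` is relatively
open in the sphere. -/
theorem Sigma2Nhd_mem_nhds {k χ : ℝ} {ω ν σ : E3} (hk : 0 < k) (hν : ν ≠ 0) (hχ : 0 < χ)
    (hσ : σ ∈ Sigma2 k ω ν) : Sigma2Nhd k ω ν χ ∈ 𝓝 σ := by
  rw [mem_Sigma2 hν] at hσ
  obtain ⟨h1, h2, h3⟩ := hσ
  have hσ0 : ‖σ‖ ≠ 0 := by rw [h1]; exact hk.ne'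
  have hc : ContinuousAt (fun x : E3 => (k / ‖x‖) • x) σ := by fun_prop (disch := assumption)
  have hv : (k / ‖σ‖) • σ = σ := by rw [h1, div_self hk.ne', one_smul]
  have e1 : ∀ᶠ x in 𝓝 σ, 0 < inner ℝ ((k / ‖x‖) • x) ω := by
    have : ContinuousAt (fun x : E3 => (inner ℝ ((k / ‖x‖) • x) ω : ℝ)) σ :=
      hc.inner continuousAt_const
    exact this.eventually_const_lt (by simpa only [hv])
  have e2 : ∀ᶠ x in 𝓝 σ, 0 < inner ℝ (refl ν ((k / ‖x‖) • x)) ω := by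
    have : ContinuousAt (fun x : E3 => (inner ℝ (refl ν ((k / ‖x‖) • x)) ω : ℝ)) σ :=
      ((continuous_refl ν).continuousAt.comp hc).inner continuousAt_const
    exact this.eventually_const_lt (by simpa only [hv])
  have e3 : ∀ᶠ x in 𝓝 σ, ‖x‖ / k ∈ Set.Ioo (1 - χ) (1 + χ) := by
    have : ContinuousAt (fun x : E3 => ‖x‖ / k) σ := by fun_prop
    apply this.eventually_mem
    rw [h1, div_self hk.ne']
    exact Ioo_mem_nhds (by linarith) (by linarith)
  have e4 : ∀ᶠ x : E3 in 𝓝 σ, ‖x‖ ≠ 0 := continuous_norm.continuousAt.eventually_ne hσ0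
  filter_upwards [e1, e2, e3, e4] with x h1 h2 h3 h4
  refine ⟨(k / ‖x‖) • x, (mem_Sigma2 hν).2 ⟨?_, h1, h2⟩, _, h3, ?_⟩
  · rw [norm_smul, norm_div, norm_norm, Real.norm_of_nonneg hk.le, div_mul_cancel₀ _ h4]
  · rw [smul_smul, div_mul_div_cancel₀ hk.ne', div_self h4, one_smul]

/-! ### The mixed derivative of a separated function -/

/-- If `b ∘ S` splits as a product of a function of `z` and a function of `z'`, which `hsep`
expresses without naming the factors, then `F ∂₁∂₂F = ∂₁F ∂₂F` for `F = b ∘ S`. Here `V z'` is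
the derivative of `S` in its first argument along `z = z₀`, and `Z` is the mixed derivative
of `S`. -/
theorem second_order_of_separated {E : Type*} [NormedAddCommGroup E] [NormedSpace ℝ E]
    {b : E → ℂ} {S : ℝ → ℝ → E} {V : ℝ → E} {z₀ z₁ : ℝ} {Y Z : E}
    (hb : ContDiffAt ℝ 2 b (S z₀ z₁))
    (hV : ∀ᶠ z' in 𝓝 z₁, HasDerivAt (fun z => S z z') (V z') z₀)
    (hY : HasDerivAt (fun z' => S z₀ z') Y z₁) (hZ : HasDerivAt V Z z₁)
    (hsep : ∀ᶠ z' in 𝓝 z₁, ∀ᶠ z in 𝓝 z₀,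
      b (S z z') * b (S z₀ z₁) = b (S z z₁) * b (S z₀ z')) :
    b (S z₀ z₁) * (fderiv ℝ (fderiv ℝ b) (S z₀ z₁) Y (V z₁) + fderiv ℝ b (S z₀ z₁) Z)
      = fderiv ℝ b (S z₀ z₁) (V z₁) * fderiv ℝ b (S z₀ z₁) Y := by
  have hbd : ∀ᶠ z' in 𝓝 z₁, DifferentiableAt ℝ b (S z₀ z') :=
    hY.continuousAt.eventually ((hb.eventually (by simp)).mono fun x hx =>
      hx.differentiableAt (by simp))
  have hD : HasFDerivAt (fderiv ℝ b) (fderiv ℝ (fderiv ℝ b) (S z₀ z₁)) (S z₀ z₁) :=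
    ((hb.fderiv_right (m := 1) (by norm_num)).differentiableAt (by simp)).hasFDerivAt
  have key : ∀ᶠ z' in 𝓝 z₁, fderiv ℝ b (S z₀ z') (V z') * b (S z₀ z₁)
      = fderiv ℝ b (S z₀ z₁) (V z₁) * b (S z₀ z') := by
    filter_upwards [hV, hbd, hsep] with z' h1 h2 h3
    have d1 := (h2.hasFDerivAt.comp_hasDerivAt z₀ h1).mul_const (b (S z₀ z₁))
    have d2 := (hbd.self_of_nhds.hasFDerivAt.comp_hasDerivAt z₀ hV.self_of_nhds).mul_const
      (b (S z₀ z'))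
    exact (d1.congr_of_eventuallyEq (h3.mono fun z hz => hz.symm)).unique d2
  have d1 := ((hD.comp_hasDerivAt z₁ hY).clm_apply hZ).mul_const (b (S z₀ z₁))
  have d2 := (hbd.self_of_nhds.hasFDerivAt.comp_hasDerivAt z₁ hY).const_mul
    (fderiv ℝ b (S z₀ z₁) (V z₁))
  have := (d1.congr_of_eventuallyEq (key.mono fun z hz => hz.symm)).unique d2
  rw [← this]
  simp only [Function.comp]
  ring

/-! ### Pairs of directions whose difference has a prescribed component orthogonal to `n` -/

/-- For an orthonormal frame `u, w, n`, let `σ` and `η = σ + r u + z n` lie on a common sphere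
around the origin, and let `η - refl n σ = r u + z' n`. This is the component of `σ`
along `u`. -/
noncomputable def circleCenter (r z z' : ℝ) : ℝ := -(r ^ 2 + z * z') / (2 * r)

/-- In the situation of `circleCenter`, with `k` the radius of the sphere, the square of the
component of `σ` along `w`. -/
noncomputable def circleRadiusSq (k r z z' : ℝ) : ℝ :=
  k ^ 2 - ((z' - z) / 2) ^ 2 - circleCenter r z z' ^ 2

/-- The point `σ` of the sphere of radius `k` with nonnegative component along `w` for which
`σ + r u + z n` lies on the same sphere and equals `refl n σ + r u + z' n`. It is meaningful only
for `r ≠ 0` and where `circleRadiusSq` is nonnegative. -/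
noncomputable def spherePoint (k r : ℝ) (u w n : E3) (z z' : ℝ) : E3 :=
  circleCenter r z z' • u + √(circleRadiusSq k r z z') • w + ((z' - z) / 2) • n

theorem circleCenter_comm (r z z' : ℝ) : circleCenter r z z' = circleCenter r z' z := by
  simp only [circleCenter, mul_comm]

theorem circleRadiusSq_comm (k r z z' : ℝ) :
    circleRadiusSq k r z z' = circleRadiusSq k r z' z := by
  simp only [circleRadiusSq, circleCenter_comm r z z']; ring

theorem hasDerivAt_circleCenter (r z z' : ℝ) :
    HasDerivAt (fun z => circleCenter r z z') (-(z' / (2 * r))) z := by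
  unfold circleCenter
  exact (((((hasDerivAt_id z).mul_const z').const_add (r ^ 2)).neg).div_const
    (2 * r)).congr_deriv (by ring)

theorem hasDerivAt_circleCenter_right (r z z' : ℝ) :
    HasDerivAt (fun z' => circleCenter r z z') (-(z / (2 * r))) z' := by
  simpa only [circleCenter_comm r z] using hasDerivAt_circleCenter r z' z

theorem hasDerivAt_circleRadiusSq (k r z z' : ℝ) :
    HasDerivAt (fun z => circleRadiusSq k r z z')
      ((z' - z) / 2 + circleCenter r z z' * z' / r) z := by
  unfold circleRadiusSq
  refine ((((((hasDerivAt_id z).const_sub z').div_const 2).pow 2).const_sub (k ^ 2)).sub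
    ((hasDerivAt_circleCenter r z z').pow 2)).congr_deriv ?_
  push_cast [id]
  ring

theorem hasDerivAt_circleRadiusSq_right (k r z z' : ℝ) :
    HasDerivAt (fun z' => circleRadiusSq k r z z')
      (-(z' - z) / 2 + circleCenter r z z' * z / r) z' := by
  simpa only [circleRadiusSq_comm k r z, circleCenter_comm r z, neg_sub] using
    hasDerivAt_circleRadiusSq k r z' z

theorem continuous_spherePoint (k r : ℝ) (u w n : E3) :
    Continuous fun p : ℝ × ℝ => spherePoint k r u w n p.1 p.2 := by
  unfold spherePoint circleRadiusSq circleCenter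
  fun_prop

theorem norm_spherePoint {k r z z' : ℝ} {u w n : E3} (hk : 0 ≤ k)
    (h : Orthonormal ℝ ![u, w, n]) (hQ : 0 ≤ circleRadiusSq k r z z') :
    ‖spherePoint k r u w n z z'‖ = k := by
  rw [← sq_eq_sq₀ (norm_nonneg _) hk, ← real_inner_self_eq_norm_sq, spherePoint,
    inner_frame h, Real.mul_self_sqrt hQ, circleRadiusSq]
  ring

theorem norm_spherePoint_add {k r z z' : ℝ} {u w n : E3} (hk : 0 ≤ k) (hr : r ≠ 0)
    (h : Orthonormal ℝ ![u, w, n]) (hQ : 0 ≤ circleRadiusSq k r z z') :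
    ‖spherePoint k r u w n z z' + (r • u + z • n)‖ = k := by
  have e : spherePoint k r u w n z z' + (r • u + z • n) = (circleCenter r z z' + r) • u +
      √(circleRadiusSq k r z z') • w + ((z' - z) / 2 + z) • n := by
    unfold spherePoint; module
  rw [← sq_eq_sq₀ (norm_nonneg _) hk, ← real_inner_self_eq_norm_sq, e,
    inner_frame h, Real.mul_self_sqrt hQ, circleRadiusSq, circleCenter]
  field_simp
  ring

theorem refl_spherePoint {k r z z' : ℝ} {u w n : E3} (h : Orthonormal ℝ ![u, w, n]) :
    refl n (spherePoint k r u w n z z') = spherePoint k r u w n z z' - (z' - z) • n := by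
  have hn : ‖n‖ = 1 := h.1 2
  rw [refl_of_norm_eq_one hn]
  congr 2
  rw [spherePoint, inner_frame_right h]
  ring

/-- At the point `spherePoint k r u w n y y'` the equation for `g` reads
`b * g (r u + y n) = -g (r u + y' n)`. Where `g (r u + y n) ≠ 0`, it exhibits `b` as a product of
a function of `y` and a function of `y'`. -/
theorem eventually_separated {k r z z' : ℝ} {u w n ω : E3} {b g : E3 → ℂ} (hk : 0 ≤ k)
    (hr : r ≠ 0) (h : Orthonormal ℝ ![u, w, n]) (hg : Continuous g)
    (hsol : ∀ η ∈ hemisphere k e3, ∀ σ ∈ Sigma2 k ω n, b σ * g (η - σ) + g (η - refl n σ) = 0)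
    (hQ : 0 < circleRadiusSq k r z z')
    (hσ : spherePoint k r u w n z z' ∈ Sigma2 k ω n)
    (hη : spherePoint k r u w n z z' + (r • u + z • n) ∈ hemisphere k e3)
    (h0 : g (r • u + z • n) ≠ 0) :
    ∀ᶠ y' in 𝓝 z', ∀ᶠ y in 𝓝 z,
      b (spherePoint k r u w n y y') * b (spherePoint k r u w n z z') =
        b (spherePoint k r u w n y z') * b (spherePoint k r u w n z y') := by
  have hn0 : n ≠ 0 := h.ne_zero 2
  have hS := continuous_spherePoint k r u w n
  have ev1 : ∀ᶠ p : ℝ × ℝ in 𝓝 (z, z'), 0 < circleRadiusSq k r p.1 p.2 := by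
    have : Continuous fun p : ℝ × ℝ => circleRadiusSq k r p.1 p.2 := by
      unfold circleRadiusSq circleCenter; fun_prop
    exact this.continuousAt.eventually_const_lt hQ
  have ev2 : ∀ᶠ p : ℝ × ℝ in 𝓝 (z, z'), 0 < inner ℝ (spherePoint k r u w n p.1 p.2) ω := by
    have : Continuous fun p : ℝ × ℝ => (inner ℝ (spherePoint k r u w n p.1 p.2) ω : ℝ) :=
      hS.inner continuous_const
    exact this.continuousAt.eventually_const_lt ((mem_Sigma2 hn0).1 hσ).2.1
  have ev3 : ∀ᶠ p : ℝ × ℝ in 𝓝 (z, z'),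
      0 < inner ℝ (refl n (spherePoint k r u w n p.1 p.2)) ω := by
    have : Continuous fun p : ℝ × ℝ =>
        (inner ℝ (refl n (spherePoint k r u w n p.1 p.2)) ω : ℝ) :=
      ((continuous_refl n).comp hS).inner continuous_const
    exact this.continuousAt.eventually_const_lt ((mem_Sigma2 hn0).1 hσ).2.2
  have ev4 : ∀ᶠ p : ℝ × ℝ in 𝓝 (z, z'),
      0 < inner ℝ (spherePoint k r u w n p.1 p.2 + (r • u + p.1 • n)) e3 := by
    have : Continuous fun p : ℝ × ℝ =>
        (inner ℝ (spherePoint k r u w n p.1 p.2 + (r • u + p.1 • n)) e3 : ℝ) :=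
      (hS.add (by fun_prop)).inner continuous_const
    exact this.continuousAt.eventually_const_lt (mem_hemisphere.1 hη).2
  have ev5 : ∀ᶠ p : ℝ × ℝ in 𝓝 (z, z'), g (r • u + p.1 • n) ≠ 0 := by
    have : Continuous fun p : ℝ × ℝ => g (r • u + p.1 • n) := hg.comp (by fun_prop)
    exact this.continuousAt.eventually_ne h0
  have key : ∀ᶠ p : ℝ × ℝ in 𝓝 (z, z'), g (r • u + p.1 • n) ≠ 0 ∧
      b (spherePoint k r u w n p.1 p.2) * g (r • u + p.1 • n) + g (r • u + p.2 • n) = 0 := by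
    filter_upwards [ev1, ev2, ev3, ev4, ev5] with p h1 h2 h3 h4 h5
    refine ⟨h5, ?_⟩
    have := hsol _ (mem_hemisphere.2 ⟨norm_spherePoint_add hk hr h h1.le, h4⟩) _
      ((mem_Sigma2 hn0).2 ⟨norm_spherePoint hk h h1.le, h2, h3⟩)
    rw [refl_spherePoint h] at this
    convert this using 4 <;> module
  rw [nhds_prod_eq, eventually_prod_iff] at key
  obtain ⟨P, hP, P', hP', hPP⟩ := key
  filter_upwards [hP'] with y' hy'
  filter_upwards [hP] with y hy
  obtain ⟨g1, a1⟩ := hPP hy hy'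
  obtain ⟨-, a2⟩ := hPP hy hP'.self_of_nhds
  obtain ⟨g2, a3⟩ := hPP hP.self_of_nhds hy'
  obtain ⟨-, a4⟩ := hPP hP.self_of_nhds hP'.self_of_nhds
  dsimp only at *
  -- Both sides, multiplied by `g (r u + y n) * g (r u + z n)`, are equal to
  -- `g (r u + y' n) * g (r u + z' n)`.
  refine mul_right_cancel₀ (mul_ne_zero g1 g2) ?_
  linear_combination (b (spherePoint k r u w n z z') * g (r • u + z • n)) * a1
    - (b (spherePoint k r u w n z y') * g (r • u + z • n)) * a2
    - g (r • u + y' • n) * a4 + g (r • u + z' • n) * a3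

/-- The differential relation for `b` at `σ` that a single `η` with `g (η - σ) ≠ 0` produces. With
`S` the parametrization `spherePoint`, the vectors are `X = ∂₁S`, `Y = ∂₂S` and `Z = ∂₁∂₂S`. Their
inner products with the independent vectors `σ`, `n` and `η` determine them. -/
theorem exists_second_order_relation {k : ℝ} {n ω η σ : E3} {b g : E3 → ℂ} (hk : 0 ≤ k)
    (hn : ‖n‖ = 1) (hη : η ∈ hemisphere k e3) (hσ : σ ∈ Sigma2 k ω n)
    (hind : LinearIndependent ℝ ![η, σ, n]) (hb : ContDiffAt ℝ 2 b σ) (hg : Continuous g)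
    (hsol : ∀ η ∈ hemisphere k e3, ∀ σ ∈ Sigma2 k ω n, b σ * g (η - σ) + g (η - refl n σ) = 0)
    (h0 : g (η - σ) ≠ 0) :
    ∃ X Y Z : E3,
      (inner ℝ X σ = (0 : ℝ) ∧ inner ℝ X n = (-1 / 2 : ℝ) ∧ inner ℝ X η = -(inner ℝ η n : ℝ)) ∧
      (inner ℝ Y σ = (0 : ℝ) ∧ inner ℝ Y n = (1 / 2 : ℝ) ∧ inner ℝ Y η = (0 : ℝ)) ∧
      (inner ℝ Z σ = -(inner ℝ X Y : ℝ) ∧ inner ℝ Z n = (0 : ℝ) ∧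
        inner ℝ Z η = -(inner ℝ X Y : ℝ) - 1 / 2) ∧
      b σ * (fderiv ℝ (fderiv ℝ b) σ Y X + fderiv ℝ b σ Z) = fderiv ℝ b σ X * fderiv ℝ b σ Y := by
  have hind' : LinearIndependent ℝ ![η - σ, σ, n] := by
    rw [linearIndependent_three] at hind ⊢
    intro x y z hxyz
    obtain ⟨h1, h2, h3⟩ := hind x (y - x) z (by rw [← hxyz]; module)
    exact ⟨h1, by linarith, h3⟩
  obtain ⟨u, w, r, z, c, q, s, h, hr, hq, hy, hσe⟩ := exists_frame hn hind'
  have hσk := (mem_hemisphere.1 hσ.1).1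
  have hηk := (mem_hemisphere.1 hη).1
  have hηe : η = (c + r) • u + q • w + (s + z) • n := by
    rw [← sub_add_cancel η σ, hy, hσe]; module
  have k1 : c ^ 2 + q ^ 2 + s ^ 2 = k ^ 2 := by
    rw [← hσk, ← real_inner_self_eq_norm_sq, hσe, inner_frame h]; ring
  have k2 : (c + r) ^ 2 + q ^ 2 + (s + z) ^ 2 = k ^ 2 := by
    rw [← hηk, ← real_inner_self_eq_norm_sq, hηe, inner_frame h]; ring
  -- The value of `z'` that belongs to `σ`, since `η - refl n σ = (η - σ) + 2 s n`.
  obtain ⟨z', hz'⟩ : ∃ z', z' = z + 2 * s := ⟨_, rfl⟩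
  have hs : (z' - z) / 2 = s := by rw [hz']; ring
  have hC : circleCenter r z z' = c := by
    rw [circleCenter, div_eq_iff (by positivity), hz']; linear_combination k1 - k2
  have hQ : circleRadiusSq k r z z' = q ^ 2 := by
    rw [circleRadiusSq, hC, hs]; linear_combination -k1
  have hQq : √(circleRadiusSq k r z z') = q := by rw [hQ, Real.sqrt_sq hq.le]
  have hσS : spherePoint k r u w n z z' = σ := by rw [spherePoint, hC, hQq, hs, hσe]
  have hQ0 : 0 < circleRadiusSq k r z z' := by rw [hQ]; positivity
  have hsep := eventually_separated (z := z) (z' := z') hk hr.ne' h hg hsol hQ0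
    (by rwa [hσS]) (by rwa [hσS, ← hy, add_sub_cancel]) (by rwa [← hy])
  have hQ' : ∀ᶠ y' in 𝓝 z', circleRadiusSq k r z y' ≠ 0 :=
    (hasDerivAt_circleRadiusSq_right k r z z').continuousAt.eventually_ne hQ0.ne'
  have hV : ∀ᶠ y' in 𝓝 z', HasDerivAt (fun y => spherePoint k r u w n y y')
      ((-(y' / (2 * r))) • u + (((y' - z) / 2 + circleCenter r z y' * y' / r) /
        (2 * √(circleRadiusSq k r z y'))) • w + (-1 / 2 : ℝ) • n) z := by
    filter_upwards [hQ'] with y' hy'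
    exact (((hasDerivAt_circleCenter r z y').smul_const u).add
      (((hasDerivAt_circleRadiusSq k r z y').sqrt hy').smul_const w)).add
      ((((hasDerivAt_id z).const_sub y').div_const 2).smul_const n)
  have hsq := (hasDerivAt_circleRadiusSq_right k r z z').sqrt hQ0.ne'
  have hY : HasDerivAt (fun y' => spherePoint k r u w n z y') _ z' :=
    (((hasDerivAt_circleCenter_right r z z').smul_const u).add (hsq.smul_const w)).add
      ((((hasDerivAt_id z').sub_const z).div_const 2).smul_const n)
  have hZ := (((((hasDerivAt_id z').div_const (2 * r)).neg).smul_const u).add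
    (((((((hasDerivAt_id z').sub_const z).div_const 2).add
      (((hasDerivAt_circleCenter_right r z z').mul (hasDerivAt_id z')).div_const r))).div
      (hsq.const_mul 2) (by rw [hQq]; positivity)).smul_const w)).add_const ((-1 / 2 : ℝ) • n)
  have key := second_order_of_separated (by rwa [hσS]) hV hY hZ hsep
  rw [hσS] at key
  refine ⟨_, _, _, ?_, ?_, ?_, key⟩
  · rw [inner_frame_right h, hηe, hσe]
    simp only [hQq, hC, inner_frame h, inner_frame_right h]
    rw [hz']
    refine ⟨?_, by norm_num, ?_⟩ <;> field_simp <;> ring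
  · rw [inner_frame_right h, hηe, hσe]
    simp only [hQq, hC, inner_frame h]
    rw [hz']
    refine ⟨?_, by norm_num, ?_⟩ <;> field_simp <;> ring
  · rw [← add_zero (_ • u + _ • w), ← zero_smul ℝ n, inner_frame_right h, hηe, hσe]
    simp only [Pi.add_apply, Pi.mul_apply, id, hQq, hC, inner_frame h]
    rw [hz']
    refine ⟨?_, trivial, ?_⟩ <;> field_simp <;> ring

/-! ### Varying `η` in a plane through `n` -/

theorem leading_coeff_eq_zero_of_eventually {α β γ δ : ℂ} {v₀ : ℝ}
    (h : ∀ᶠ v : ℝ in 𝓝[>] v₀, α * (v : ℂ) ^ 3 + β * (v : ℂ) ^ 2 + γ * v + δ = 0) : α = 0 := by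
  obtain ⟨v₁, hv₁, hsub⟩ := (mem_nhdsGT_iff_exists_Ioo_subset).1 h
  let p : Polynomial ℂ := .C α * .X ^ 3 + .C β * .X ^ 2 + .C γ * .X + .C δ
  have hp : p = 0 := by
    refine p.eq_zero_of_infinite_isRoot
      (((Set.Ioo_infinite hv₁).image Complex.ofReal_injective.injOn).mono ?_)
    rintro _ ⟨v, hv, rfl⟩
    simpa [p] using hsub hv
  have := congrArg (fun q => Polynomial.coeff q 3) hp
  simpa [p, Polynomial.coeff_X, Polynomial.coeff_C] using this

/-- Coordinates `x`, `y`, `z` of the vectors of `exists_second_order_relation`, for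
`σ = ρ u + s n` and `η = (k / v) (C u + S w + τ n)`. The parameter `τ` enters only through
`v = √(1 + τ ^ 2)`: `x₂ - y₂` is constant, `x₂ * y₂` and `z₁` are polynomials in `v ^ 2`, and `z₂`
is a polynomial in `v` of degree three. -/
theorem tangent_coords {k v ρ s C S τ x₁ x₂ x₃ y₁ y₂ y₃ z₁ z₂ : ℝ} (hk : k ≠ 0) (hv : v ≠ 0)
    (hρ : ρ ≠ 0) (hS : S ≠ 0) (hτ : τ ^ 2 = v ^ 2 - 1)
    (hx₃ : x₃ = -1 / 2) (hx : x₁ * ρ + x₃ * s = 0)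
    (hxη : x₁ * (k / v * C) + x₂ * (k / v * S) + x₃ * (k / v * τ) = -(k / v * τ))
    (hy₃ : y₃ = 1 / 2) (hy : y₁ * ρ + y₃ * s = 0)
    (hyη : y₁ * (k / v * C) + y₂ * (k / v * S) + y₃ * (k / v * τ) = 0)
    (hz : z₁ * ρ = -(x₁ * y₁ + x₂ * y₂ + x₃ * y₃))
    (hzη : z₁ * (k / v * C) + z₂ * (k / v * S) =
      -(x₁ * y₁ + x₂ * y₂ + x₃ * y₃) - 1 / 2) :
    x₁ = s / ρ / 2 ∧ y₁ = -(s / ρ) / 2 ∧ x₂ - y₂ = -(s / ρ * C / S) ∧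
      x₂ * y₂ = 1 / (4 * S ^ 2) * v ^ 2 - (1 + (s / ρ) ^ 2 * C ^ 2) / (4 * S ^ 2) ∧
      z₁ = ((1 + (s / ρ) ^ 2) / 4 - x₂ * y₂) / ρ ∧
      z₂ = ((((s / ρ) ^ 2 - 1) / 4 - x₂ * y₂) * v / k - z₁ * C) / S := by
  obtain ⟨a, ha⟩ : ∃ a, a = s / ρ := ⟨_, rfl⟩
  have hs : s = a * ρ := by rw [ha]; field_simp
  rw [← ha]
  have hkv : k / v ≠ 0 := div_ne_zero hk hv
  have hx₁ : x₁ = a / 2 := by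
    apply mul_right_cancel₀ hρ; rw [hx₃, hs] at hx; linear_combination hx
  have hy₁ : y₁ = -a / 2 := by
    apply mul_right_cancel₀ hρ; rw [hy₃, hs] at hy; linear_combination hy
  have hx₂ : x₂ = -(τ + a * C) / (2 * S) := by
    have := mul_left_cancel₀ hkv (b := x₁ * C + x₂ * S + x₃ * τ) (c := -τ)
      (by linear_combination hxη)
    rw [hx₃, hx₁] at this
    field_simp
    linear_combination 2 * this
  have hy₂ : y₂ = (a * C - τ) / (2 * S) := by
    have := mul_left_cancel₀ hkv (b := y₁ * C + y₂ * S + y₃ * τ) (c := 0)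
      (by linear_combination hyη)
    rw [hy₃, hy₁] at this
    field_simp
    linear_combination 2 * this
  refine ⟨hx₁, by rw [hy₁], ?_, ?_, ?_, ?_⟩
  · rw [hx₂, hy₂]; field_simp; ring
  · rw [hx₂, hy₂]; field_simp; linear_combination 4 * hτ
  · rw [hx₁, hy₁, hx₃, hy₃] at hz
    rw [eq_div_iff hρ]; linear_combination hz
  · rw [hx₁, hy₁, hx₃, hy₃] at hzη
    rw [eq_div_iff hS]; field_simp at hzη ⊢; linear_combination hzη

/-- With `σ` fixed and `η` moved in the plane through `η` and `n`, the relation of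
`exists_second_order_relation` becomes a cubic polynomial equation in one real parameter. Its
leading coefficient is a nonzero multiple of `b σ` times the derivative of `b` at `σ` in the
direction orthogonal to `σ` and `n`. -/
theorem fderiv_apply_eq_zero {k : ℝ} {n ω η σ e : E3} {b g : E3 → ℂ} (hk : 0 < k)
    (hn : ‖n‖ = 1) (hη : η ∈ hemisphere k e3) (hσ : σ ∈ Sigma2 k ω n)
    (hind : LinearIndependent ℝ ![η, σ, n]) (hb : ContDiffAt ℝ 2 b σ) (hb0 : b σ ≠ 0)
    (hg : Continuous g)
    (hsol : ∀ η ∈ hemisphere k e3, ∀ σ ∈ Sigma2 k ω n, b σ * g (η - σ) + g (η - refl n σ) = 0)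
    (h0 : g (η - σ) ≠ 0) (heσ : inner ℝ e σ = (0 : ℝ)) (hen : inner ℝ e n = (0 : ℝ)) :
    fderiv ℝ b σ e = 0 := by
  have hind' : LinearIndependent ℝ ![σ, η, n] := by
    rw [linearIndependent_three] at hind ⊢
    intro x y z hxyz
    obtain ⟨h1, h2, h3⟩ := hind y x z (by rw [← hxyz]; module)
    exact ⟨h2, h1, h3⟩
  obtain ⟨u, w, ρ, s, c, q, t, h, hρ, hq, hσe, hηe⟩ := exists_frame hn hind'
  have hw : fderiv ℝ b σ w = 0 := by
    obtain ⟨κ, hκ⟩ : ∃ κ, κ = √(c ^ 2 + q ^ 2) := ⟨_, rfl⟩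
    have hκ2 : κ ^ 2 = c ^ 2 + q ^ 2 := by rw [hκ, Real.sq_sqrt (by positivity)]
    have hκ0 : 0 < κ := by rw [hκ]; positivity
    have hkκ : κ ^ 2 + t ^ 2 = k ^ 2 := by
      rw [hκ2, ← (mem_hemisphere.1 hη).1, ← real_inner_self_eq_norm_sq, hηe, inner_frame h]; ring
    obtain ⟨C, hC⟩ : ∃ C, C = c / κ := ⟨_, rfl⟩
    obtain ⟨S, hS⟩ : ∃ S, S = q / κ := ⟨_, rfl⟩
    have hS0 : 0 < S := by rw [hS]; positivity
    have hCS : C ^ 2 + S ^ 2 = 1 := by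
      rw [hC, hS]; field_simp; linear_combination -hκ2
    -- The sign of `t`, so that a square root recovers `t` below.
    obtain ⟨ε, hε, ht⟩ : ∃ ε : ℝ, ε ^ 2 = 1 ∧ t = ε * |t| := by
      rcases le_total 0 t with h | h
      · exact ⟨1, by norm_num, by rw [abs_of_nonneg h]; ring⟩
      · exact ⟨-1, by norm_num, by rw [abs_of_nonpos h]; ring⟩
    obtain ⟨v₀, hv₀⟩ : ∃ v₀, v₀ = k / κ := ⟨_, rfl⟩
    have hv₀0 : 0 < v₀ := by rw [hv₀]; positivity
    have hv₀1 : 1 ≤ v₀ ^ 2 := by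
      rw [hv₀, div_pow, le_div_iff₀ (by positivity)]; nlinarith [sq_nonneg t]
    -- The curve of admissible `η`: it keeps the direction of the part orthogonal to `n`, and that
    -- part has length `k / v`.
    let H : ℝ → E3 := fun v => (k / v * C) • u + (k / v * S) • w + (k / v * (ε * √(v ^ 2 - 1))) • n
    have hH0 : H v₀ = η := by
      have e1 : k / v₀ = κ := by rw [hv₀]; field_simp
      have e2 : √(v₀ ^ 2 - 1) = |t| / κ := by
        rw [← abs_of_pos hκ0, ← abs_div, ← Real.sqrt_sq_eq_abs, hv₀]
        congr 1; field_simp; linear_combination -hkκ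
      simp only [H, e1, e2]
      rw [hηe]
      have hc' : κ * C = c := by rw [hC]; field_simp
      have hq' : κ * S = q := by rw [hS]; field_simp
      have ht' : κ * (ε * (|t| / κ)) = t := by rw [mul_left_comm, mul_div_cancel₀ _ hκ0.ne', ← ht]
      rw [hc', hq', ht']
    have hHc : ContinuousAt H v₀ := by fun_prop (disch := exact hv₀0.ne')
    have ev1 : ∀ᶠ v in 𝓝 v₀, 0 < inner ℝ (H v) e3 := by
      have : ContinuousAt (fun v => (inner ℝ (H v) e3 : ℝ)) v₀ := hHc.inner continuousAt_const
      exact this.eventually_const_lt (by simpa only [hH0] using (mem_hemisphere.1 hη).2)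
    have ev2 : ∀ᶠ v in 𝓝 v₀, g (H v - σ) ≠ 0 := by
      have : ContinuousAt (fun v => g (H v - σ)) v₀ :=
        hg.continuousAt.comp (hHc.sub continuousAt_const)
      exact this.eventually_ne (by simpa only [hH0] using h0)
    obtain ⟨a, ha⟩ : ∃ a, a = s / ρ := ⟨_, rfl⟩
    obtain ⟨p₀, hp₀⟩ : ∃ p₀, p₀ = -((1 + a ^ 2 * C ^ 2) / (4 * S ^ 2)) := ⟨_, rfl⟩
    obtain ⟨p₂, hp₂⟩ : ∃ p₂, p₂ = 1 / (4 * S ^ 2) := ⟨_, rfl⟩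
    obtain ⟨d, hd⟩ : ∃ d, d = -(a * C / S) := ⟨_, rfl⟩
    obtain ⟨L, hL⟩ : ∃ L, L = fderiv ℝ b σ := ⟨_, rfl⟩
    obtain ⟨B, hB⟩ : ∃ B, B = fderiv ℝ (fderiv ℝ b) σ := ⟨_, rfl⟩
    have hsymm : ∀ x y, B x y = B y x := by
      have := hb.isSymmSndFDerivAt (by simp)
      intro x y; rw [hB]; exact this x y
    -- Only `v > v₀` is used: `v₀ = 1` is possible, and the square root needs `1 ≤ v ^ 2`.
    have hrel : ∀ᶠ v : ℝ in 𝓝[>] v₀,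
        (b σ * L w * ((-p₂ / (k * S) : ℝ) : ℂ)) * (v : ℂ) ^ 3 +
        (b σ * (p₂ * B w w + ((-p₂ / ρ : ℝ) : ℂ) * L u + ((p₂ * C / (ρ * S) : ℝ) : ℂ) * L w)
          - p₂ * (L w) ^ 2) *
          (v : ℂ) ^ 2 +
        (b σ * L w * ((((a ^ 2 - 1) / 4 - p₀) / (k * S) : ℝ) : ℂ)) * v +
        (b σ * (p₀ * B w w + d / 2 * B w (n - a • u) - 1 / 4 * B (n - a • u) (n - a • u)
            + ((((1 + a ^ 2) / 4 - p₀) / ρ : ℝ) : ℂ) * L u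
            - ((((1 + a ^ 2) / 4 - p₀) * C / (ρ * S) : ℝ) : ℂ) * L w)
          - (p₀ * (L w) ^ 2 + d / 2 * L w * L (n - a • u) - 1 / 4 * (L (n - a • u)) ^ 2)) = 0 := by
      filter_upwards [ev1.filter_mono nhdsWithin_le_nhds, ev2.filter_mono nhdsWithin_le_nhds,
        self_mem_nhdsWithin] with v h1 h2 h3
      have hv : v₀ < v := h3
      have hv0 : 0 < v := hv₀0.trans hv
      have hτ : (ε * √(v ^ 2 - 1)) ^ 2 = v ^ 2 - 1 := by
        rw [mul_pow, hε, one_mul, Real.sq_sqrt]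
        nlinarith
      have hnorm : ‖H v‖ = k := by
        rw [← sq_eq_sq₀ (norm_nonneg _) hk.le, ← real_inner_self_eq_norm_sq]
        simp only [H]
        rw [inner_frame h]
        have : (k / v) ^ 2 * v ^ 2 = k ^ 2 := by field_simp
        linear_combination (k / v) ^ 2 * hCS + (k / v) ^ 2 * hτ + this
      have hindv : LinearIndependent ℝ ![H v, σ, n] := by
        rw [linearIndependent_three]
        intro x y z hxyz
        have e : (x * (k / v * C) + y * ρ) • u + (x * (k / v * S)) • w +
            (x * (k / v * (ε * √(v ^ 2 - 1))) + y * s + z) • n = 0 := by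
          rw [← hxyz, hσe]; simp only [H]; module
        obtain ⟨f1, f2⟩ := inner_frame_left h (x * (k / v * C) + y * ρ) (x * (k / v * S))
          (x * (k / v * (ε * √(v ^ 2 - 1))) + y * s + z)
        have f3 := inner_frame_right h (x * (k / v * C) + y * ρ) (x * (k / v * S))
          (x * (k / v * (ε * √(v ^ 2 - 1))) + y * s + z)
        rw [e, inner_zero_left] at f1 f2 f3
        have hx : x = 0 := by
          have : k / v * S ≠ 0 := by positivity
          simpa [this] using f2.symm
        have hy : y = 0 := by simpa [hx, hρ.ne'] using f1.symm
        exact ⟨hx, hy, by simpa [hx, hy] using f3.symm⟩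
      obtain ⟨X, Y, Z, ⟨hX1, hX2, hX3⟩, ⟨hY1, hY2, hY3⟩, ⟨hZ1, hZ2, hZ3⟩, rel⟩ :=
        exists_second_order_relation hk.le hn (mem_hemisphere.2 ⟨hnorm, h1⟩) hσ hindv hb hg hsol h2
      rw [← hB, ← hL] at rel
      obtain ⟨x₁, x₂, x₃, hX⟩ := exists_coord h X
      obtain ⟨y₁, y₂, y₃, hY⟩ := exists_coord h Y
      obtain ⟨z₁, z₂, z₃, hZ⟩ := exists_coord h Z
      have hσ' : σ = ρ • u + (0 : ℝ) • w + s • n := by rw [hσe]; module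
      rw [hX, inner_frame_right h] at hX2
      rw [hY, inner_frame_right h] at hY2
      rw [hZ, inner_frame_right h] at hZ2
      subst hZ2
      simp only [H, inner_frame_right h] at hX3 hY3 hZ3
      rw [hX, hσ', inner_frame h] at hX1
      rw [hX, inner_frame h] at hX3
      rw [hY, hσ', inner_frame h] at hY1
      rw [hY, inner_frame h] at hY3
      rw [hX, hY, hZ, hσ', inner_frame h, inner_frame h] at hZ1
      rw [hX, hY, hZ, inner_frame h, inner_frame h] at hZ3
      simp only [mul_zero, zero_mul, add_zero] at hX1 hY1 hZ1 hZ3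
      obtain ⟨r1, r2, r3, r4, r5, r6⟩ := tangent_coords hk.ne' hv0.ne' hρ.ne' hS0.ne' hτ
        hX2 hX1 hX3 hY2 hY1 hY3 hZ1 hZ3
      rw [← ha] at r1 r2 r3 r4 r5 r6
      rw [← hd] at r3
      have r4' : x₂ * y₂ = p₂ * v ^ 2 + p₀ := by rw [r4, hp₀, hp₂]; ring
      have hX' : X = x₂ • w - (1 / 2 : ℝ) • (n - a • u) := by rw [hX, r1, hX2]; module
      have hY' : Y = y₂ • w + (1 / 2 : ℝ) • (n - a • u) := by rw [hY, r2, hY2]; module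
      have hz₁ : z₁ = -p₂ / ρ * v ^ 2 + ((1 + a ^ 2) / 4 - p₀) / ρ := by
        rw [r5, r4']; ring
      have hz₂ : z₂ = -p₂ / (k * S) * v ^ 3 + p₂ * C / (ρ * S) * v ^ 2 +
          ((a ^ 2 - 1) / 4 - p₀) / (k * S) * v - ((1 + a ^ 2) / 4 - p₀) * C / (ρ * S) := by
        rw [r6, hz₁, r4']; field_simp; ring
      have hZ' : Z = z₁ • u + z₂ • w := by rw [hZ]; module
      rw [hX', hY', hZ'] at rel
      generalize n - a • u = f at *
      simp only [map_add, map_sub, map_smul, add_apply,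
        smul_apply, Complex.real_smul] at rel
      rw [hsymm f w] at rel
      have r3c : (x₂ : ℂ) - y₂ = d := by exact_mod_cast r3
      have r4c : (x₂ : ℂ) * y₂ = p₂ * v ^ 2 + p₀ := by exact_mod_cast r4'
      have hz₁c := congrArg Complex.ofReal hz₁
      have hz₂c := congrArg Complex.ofReal hz₂
      push_cast at hz₁c hz₂c rel ⊢
      linear_combination rel - (b σ * B w w - L w ^ 2) * r4c -
        (b σ * B w f - L w * L f) / 2 * r3c - b σ * L u * hz₁c - b σ * L w * hz₂c
    have hlead := leading_coeff_eq_zero_of_eventually hrel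
    rw [← hL]
    have hp₂0 : p₂ ≠ 0 := by rw [hp₂]; positivity
    have : (-p₂ / (k * S)) ≠ 0 := by simp [hp₂0, hk.ne', hS0.ne']
    rcases mul_eq_zero.1 hlead with h' | h'
    · exact (mul_eq_zero.1 h').resolve_left hb0
    · exact absurd (Complex.ofReal_eq_zero.1 h') this
  obtain ⟨x, y, z, he⟩ := exists_coord h e
  rw [he, inner_frame_right h] at hen
  subst hen
  have hσ' : σ = ρ • u + (0 : ℝ) • w + s • n := by rw [hσe]; module
  rw [he, hσ', inner_frame h] at heσ
  have hx : x = 0 := by simpa [hρ.ne'] using heσ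
  rw [he, hx]
  simp [hw]

/-! ### The direction `ν × σ` and the conclusion -/

theorem inner_cross_left (u v : E3) : inner ℝ (cross u v) u = (0 : ℝ) := by
  simp [cross, EuclideanSpace.inner_eq_star_dotProduct]

theorem inner_cross_right (u v : E3) : inner ℝ (cross u v) v = (0 : ℝ) := by
  simp [cross, EuclideanSpace.inner_eq_star_dotProduct]

end Scan

theorem mainTheorem4
    (k₀ : ℝ) (hk₀ : 0 < k₀)
    (ν ω : Scan.E3) (hν : ν ≠ 0) (hω : ω ≠ 0)
    (χ : ℝ) (hχ : χ ∈ Set.Ioo (0 : ℝ) 1)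
    (b : Scan.E3 → ℂ)
    (hb_ne : ∀ x ∈ Scan.Sigma2Nhd k₀ ω ν χ, b x ≠ 0)
    (hb_radial : ∀ σ ∈ Scan.Sigma2 k₀ ω ν, ∀ t ∈ Set.Ioo (1 - χ) (1 + χ), b (t • σ) = b σ)
    (hb_smooth : ContDiffOn ℝ 2 b (Scan.Sigma2Nhd k₀ ω ν χ))
    (η σ : Scan.E3) (hη : η ∈ Scan.hemisphere k₀ Scan.e3) (hσ : σ ∈ Scan.Sigma2 k₀ ω ν)
    (hind : LinearIndependent ℝ ![η, σ, ν])
    (hDb : fderiv ℝ b σ (Scan.cross ν σ) ≠ 0)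
    (g : Scan.E3 → ℂ) (hg_cont : Continuous g) (hg : Scan.IsSolution k₀ ω ν b g) :
    g (η - σ) = 0 := by
  have hnhds := Scan.Sigma2Nhd_mem_nhds hk₀ hν hχ.1 hσ
  have hν0 : ‖ν‖ ≠ 0 := norm_ne_zero_iff.2 hν
  have hrefl := Scan.refl_smul (inv_ne_zero hν0) ν
  have hS2 : Scan.Sigma2 k₀ ω (‖ν‖⁻¹ • ν) = Scan.Sigma2 k₀ ω ν := by
    simp only [Scan.Sigma2, hrefl]
  by_contra h0
  refine hDb (Scan.fderiv_apply_eq_zero (n := ‖ν‖⁻¹ • ν) hk₀ ?_ hη (hS2 ▸ hσ) ?_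
    (hb_smooth.contDiffAt hnhds) (hb_ne σ (mem_of_mem_nhds hnhds)) hg_cont ?_ h0
    (Scan.inner_cross_right ν σ) ?_)
  · rw [norm_smul, norm_inv, norm_norm, inv_mul_cancel₀ hν0]
  · rw [Scan.linearIndependent_three] at hind ⊢
    intro x y z hxyz
    obtain ⟨h1, h2, h3⟩ := hind x y (z * ‖ν‖⁻¹) (by rw [← hxyz]; module)
    exact ⟨h1, h2, by simpa [hν0] using h3⟩
  · intro η' hη' σ' hσ'
    rw [hrefl]
    exact (hg η' hη').2 σ' (hS2 ▸ hσ')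
  · rw [real_inner_smul_right, Scan.inner_cross_left, mul_zero]
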